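/- Let $0<q<1$ and $\nu\in\mathbb R$. Put $(a;q)_k=\prod_{i=0}^{k-1}(1-aq^i)$, $(a;q)_\infty=\prod_{i=0}^{\infty}(1-aq^i)$ and define $$j_\nu(x;q)=x^\nu\,(qx^2;q)_\infty\;{}_1\varphi_1\bigl(0;qx^2;q,q^{\nu+1}x^2\bigr),\qquad {}_1\varphi_1(0;b;q,z)=\sum_{k=0}^\infty\frac{(-1)^kq^{k(k-1)/2}}{(q;q)_k\,(b;q)_k}\,z^k ,$$ where the removable singularities of $(qx^2;q)_\infty\,{}_1\varphi_1$ at the points with $qx^2=q^{-n}$, $n=0,1,2,\dots$, are removed, i.e. $$x^{-\nu}j_\nu(x;q)=\sum_{k=0}^\infty\frac{(-1)^kq^{k(k-1)/2}\,(q^{k+1}x^2;q)_\infty}{(q;q)_k}\,\bigl(q^{\nu+1}x^2\bigr)^k ,$$ a function on $\mathbb C$ with value $1$ at $x=0$. Then: (i) $j_\nu(x;q)$ and $j_{\nu+1}(x;q)$ have no common zeros $x\in\mathbb C$, except possibly $x=0$. (ii) All zeros in $\mathbb C$ of $x^{-\nu}j_\nu(x;q)$ are real and simple, and they are symmetric with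 respect to $x=0$. There are infinitely many of them, and their only point of accumulation in $\mathbb C\cup\{\infty\}$ is $\infty$. (iii) The zeros of $x^{-\nu}j_\nu(x;q)$ and $x^{-\nu-1}j_{\nu+1}(x;q)$ interlace: the positive zeros of the two functions can be numbered increasingly as $x_1^{\nu}<x_2^{\nu}<\cdots$ and $x_1^{\nu+1}<x_2^{\nu+1}<\cdots$, and $x_n^{\nu}<x_n^{\nu+1}<x_{n+1}^{\nu}$ for all $n\ge 1$. In particular, the smallest positive zero of $x^{-\nu}j_\nu(x;q)$ is smaller than the smallest positive zero of $x^{-\nu-1}j_{\nu+1}(x;q)$. -/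

import Mathlib

/-- The finite `q`-shifted factorial `(a;q)_k = ∏_{i=0}^{k-1} (1 - a q^i)`. -/
def qPoch (q a : ℂ) (k : ℕ) : ℂ := ∏ i ∈ Finset.range k, (1 - a * q ^ i)

/-- The infinite `q`-shifted factorial `(a;q)_∞ = ∏_{i=0}^∞ (1 - a q^i)` (for `|q| < 1`). -/
noncomputable def qPochInf (q a : ℂ) : ℂ := ∏' i : ℕ, (1 - a * q ^ i)

/-- The basic hypergeometric series `₁φ₁(a; b; q, z)`, meaningful when `(b;q)_k ≠ 0` for
all `k`. -/
noncomputable def phi11 (q a b z : ℂ) : ℂ :=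
  ∑' k : ℕ, qPoch q a k / (qPoch q q k * qPoch q b k) * ((-1) ^ k * q ^ (k.choose 2)) * z ^ k

/-- The product `(b;q)_∞ ₁φ₁(a; b; q, z)`, with the removable singularities at the points
where `(b;q)_k = 0` for some `k` removed: `(b;q)_∞` is multiplied into the series termwise,
using `(b;q)_∞ / (b;q)_k = (b q^k;q)_∞`. -/
noncomputable def phi11Reg (q a b z : ℂ) : ℂ :=
  ∑' k : ℕ, qPoch q a k * qPochInf q (b * q ^ k) / qPoch q q k *
    ((-1) ^ k * q ^ (k.choose 2)) * z ^ k

theorem qPochInf_eq_mul {q : ℂ} (hq : ‖q‖ < 1) (b : ℂ) (k : ℕ) :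
    qPochInf q b = qPoch q b k * qPochInf q (b * q ^ k) := by
  have hm : ∀ c : ℂ, Multipliable fun i : ℕ => (1 - c * q ^ i) := by
    intro c
    have hs : Summable fun i : ℕ => ‖-(c * q ^ i)‖ := by
      simp only [norm_neg, norm_mul, norm_pow]
      exact (summable_geometric_of_lt_one (norm_nonneg q) hq).mul_left _
    simpa [sub_eq_add_neg] using multipliable_one_add_of_summable hs
  have e : ∀ i : ℕ, 1 - b * q ^ k * q ^ i = 1 - b * q ^ (i + k) := fun i => by ring
  have h2 : Multipliable fun i : ℕ => (1 - b * q ^ (i + k)) := by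
    simpa only [e] using hm (b * q ^ k)
  unfold qPochInf qPoch
  simp only [e]
  exact (Multipliable.prod_mul_tprod_nat_mul' (f := fun i : ℕ => 1 - b * q ^ i) h2).symm

/-- Away from the removable singularities `phi11Reg` is literally `(b;q)_∞ ₁φ₁(a; b; q, z)`. -/
theorem phi11Reg_eq {q : ℂ} (hq : ‖q‖ < 1) (a b z : ℂ) (hb : ∀ k, qPoch q b k ≠ 0) :
    phi11Reg q a b z = qPochInf q b * phi11 q a b z := by
  unfold phi11Reg phi11
  rw [← tsum_mul_left]
  refine tsum_congr fun k => ?_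
  rw [qPochInf_eq_mul hq b k, div_mul_eq_div_div, div_right_comm]
  have := hb k
  field_simp

/-- The entire function `x^{-ν} j_ν(x;q) = (qx²;q)_∞ ₁φ₁(0; qx²; q, q^{ν+1} x²)`
(removable singularities removed; its value at `x = 0` is `1`). -/
noncomputable def jEntire (q ν : ℝ) (x : ℂ) : ℂ :=
  phi11Reg (q : ℂ) 0 ((q : ℂ) * x ^ 2) (((q ^ (ν + 1) : ℝ) : ℂ) * x ^ 2)

/-- `j_ν(x;q) = x^ν (qx²;q)_∞ ₁φ₁(0; qx²; q, q^{ν+1} x²)`, with the principal branch of `x^ν`. -/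
noncomputable def jFun (q ν : ℝ) (x : ℂ) : ℂ := x ^ (ν : ℂ) * jEntire q ν x

theorem jFun_eq {q : ℝ} (hq0 : 0 < q) (hq1 : q < 1) (ν : ℝ) (x : ℂ)
    (hx : ∀ k, qPoch (q : ℂ) ((q : ℂ) * x ^ 2) k ≠ 0) :
    jFun q ν x = x ^ (ν : ℂ) * (qPochInf (q : ℂ) ((q : ℂ) * x ^ 2) *
      phi11 (q : ℂ) 0 ((q : ℂ) * x ^ 2) (((q ^ (ν + 1) : ℝ) : ℂ) * x ^ 2)) := by
  unfold jFun jEntire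
  rw [phi11Reg_eq (by simpa [abs_of_pos hq0] using hq1) _ _ _ hx]

theorem cpow_neg_mul_jFun (q ν : ℝ) {x : ℂ} (hx : x ≠ 0) :
    x ^ (-(ν : ℂ)) * jFun q ν x = jEntire q ν x := by
  unfold jFun
  rw [← mul_assoc, ← Complex.cpow_add _ _ hx]
  simp

theorem jEntire_zero (q ν : ℝ) : jEntire q ν 0 = 1 := by
  unfold jEntire phi11Reg
  rw [tsum_eq_single 0 (by intro k hk; simp [hk])]
  simp [qPoch, qPochInf]

/-- The set of (complex) zeros of `x^{-ν} j_ν(x;q)`. -/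
def jZeros (q ν : ℝ) : Set ℂ := {x | jEntire q ν x = 0}

/-- The set of positive real zeros of `x^{-ν} j_ν(x;q)`. -/
def jPosZeros (q ν : ℝ) : Set ℝ := {x | 0 < x ∧ jEntire q ν (x : ℂ) = 0}

open Filter Topology Complex

/-! With `w = x²` and `t = q^ν`, the entire function becomes `J_t(w)` (`jSeries`), with `J_t(0) =
1`, and raising `ν` by one replaces `t` by `qt`. Two contiguous relations between `J_t` and `J_{qt}`
at `w` and `qw` combine into a three-term recurrence for `J_t(w)`, `J_t(qw)`, `J_t(q²w)`. Iteration
of `w ↦ qw` tends to `0`, where every quantity is known, so an inequality preserved by the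
recurrence passes from near `0` back to `w`.

This gives three facts. A Lagrange identity for `J_t` and its conjugate excludes nonreal `w` as
zeros (`im_eq_zero_of_jSeries_eq_zero`). Joint positivity of `J_t` and `J_{qt}` excludes `w ≤ 0`
(`jReal_pos_of_nonpos`), so every zero `x` is real and nonzero. The Wronskian of `J_t(y)` and `y
J_t(qy)` is positive (`jReal_wronskian_pos`); up to the factor `tq` it is that of `J_t` and
`J_{qt}`.

Positivity of this Wronskian makes zeros simple, excludes common zeros and, by Sturm's argument,
forces interlacing; the equal values at `0` decide which function vanishes first. Unboundedness of
the zeros is a sign argument in the recurrence (`exists_jReal_eq_zero_gt`). -/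

/-! ### Convergence and conjugation of `q`-shifted factorials -/

theorem multipliable_one_sub_mul_pow {q : ℂ} (hq : ‖q‖ < 1) (b : ℂ) :
    Multipliable fun i : ℕ => 1 - b * q ^ i := by
  have hs : Summable fun i : ℕ => ‖-(b * q ^ i)‖ := by
    simp only [norm_neg, norm_mul, norm_pow]
    exact (summable_geometric_of_lt_one (norm_nonneg q) hq).mul_left _
  simpa [sub_eq_add_neg] using multipliable_one_add_of_summable hs

theorem qPochInf_eq_one_sub_mul {q : ℂ} (hq : ‖q‖ < 1) (b : ℂ) :
    qPochInf q b = (1 - b) * qPochInf q (b * q) := by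
  simpa [qPoch] using qPochInf_eq_mul hq b 1

theorem differentiable_qPochInf {q : ℂ} (hq : ‖q‖ < 1) : Differentiable ℂ (qPochInf q) := by
  intro b
  have hs : Summable fun i : ℕ => (‖b‖ + 1) * ‖q‖ ^ i :=
    (summable_geometric_of_lt_one (norm_nonneg q) hq).mul_left _
  have h := hs.hasProdLocallyUniformlyOn_nat_one_add (f := fun i x => -(x * q ^ i))
    (Metric.isOpen_ball (x := (0 : ℂ)) (ε := ‖b‖ + 1))
    (.of_forall fun i x hx => by
      rw [norm_neg, norm_mul, norm_pow]
      have : ‖x‖ < ‖b‖ + 1 := by simpa using hx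
      gcongr) (fun i => by fun_prop)
  have hd := h.differentiableOn
    (.of_forall fun s => by
      simpa [Finset.prod_fn] using DifferentiableOn.finsetProd (fun _ _ => by fun_prop))
    Metric.isOpen_ball
  have hb := hd.differentiableAt (Metric.isOpen_ball.mem_nhds (x := b) (by simp))
  have e : (fun x : ℂ => ∏' i : ℕ, (1 + -(x * q ^ i))) = qPochInf q := by
    funext x; simp [qPochInf, sub_eq_add_neg]
  rwa [e] at hb

theorem conj_qPoch (q : ℝ) (a : ℂ) (k : ℕ) :
    (starRingEnd ℂ) (qPoch q a k) = qPoch q ((starRingEnd ℂ) a) k := by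
  simp [qPoch, map_prod]

theorem conj_qPochInf {q : ℝ} (hq0 : 0 < q) (hq1 : q < 1) (b : ℂ) :
    (starRingEnd ℂ) (qPochInf q b) = qPochInf q ((starRingEnd ℂ) b) := by
  have hq : ‖(q : ℂ)‖ < 1 := by simpa [abs_of_pos hq0] using hq1
  unfold qPochInf
  rw [(multipliable_one_sub_mul_pow hq b).map_tprod (starRingEnd ℂ) continuous_conj]
  simp

theorem qPoch_succ (q a : ℂ) (k : ℕ) : qPoch q a (k + 1) = qPoch q a k * (1 - a * q ^ k) := by
  simp [qPoch, Finset.prod_range_succ]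

theorem one_sub_pow_succ_ne_zero {q : ℝ} (hq0 : 0 < q) (hq1 : q < 1) (k : ℕ) :
    (1 - (q : ℂ) * (q : ℂ) ^ k) ≠ 0 := by
  have : q * q ^ k < 1 := by
    rw [← pow_succ']; exact pow_lt_one₀ hq0.le hq1 (by simp)
  have h : (1 - q * q ^ k : ℝ) ≠ 0 := by linarith
  exact_mod_cast h

theorem qPoch_self_ne_zero {q : ℝ} (hq0 : 0 < q) (hq1 : q < 1) (k : ℕ) :
    qPoch (q : ℂ) q k ≠ 0 :=
  Finset.prod_ne_zero_iff.2 fun i _ => one_sub_pow_succ_ne_zero hq0 hq1 i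

/-- The coefficients of `₁φ₁`-type series are summable against every geometric sequence. -/
theorem summable_pow_choose_div_qPoch {q : ℝ} (hq0 : 0 < q) (hq1 : q < 1) (r : ℂ) :
    Summable fun k : ℕ => ((q : ℂ) ^ k.choose 2 / qPoch q q k * r ^ k) := by
  rcases eq_or_ne r 0 with rfl | hr
  · exact summable_of_ne_finset_zero (s := {0}) (fun k hk => by
      have : k ≠ 0 := by simpa using hk
      simp [this])
  have hqc : (q : ℂ) ≠ 0 := by exact_mod_cast hq0.ne'
  have hne := qPoch_self_ne_zero hq0 hq1
  refine summable_of_ratio_test_tendsto_lt_one (l := 0) zero_lt_one (.of_forall fun k => ?_) ?_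
  · exact mul_ne_zero (div_ne_zero (pow_ne_zero _ hqc) (hne k)) (pow_ne_zero _ hr)
  have hp : Tendsto (fun k : ℕ => (q : ℂ) ^ k) atTop (𝓝 0) :=
    tendsto_pow_atTop_nhds_zero_of_norm_lt_one (by simpa [abs_of_pos hq0] using hq1)
  have : Tendsto (fun k : ℕ => ‖(q : ℂ) ^ k * r / (1 - q * (q : ℂ) ^ k)‖) atTop (𝓝 0) := by
    have h := ((hp.mul_const r).div ((tendsto_const_nhds (x := (1 : ℂ))).sub
      (hp.const_mul (q : ℂ))) (by simp)).norm
    simpa using h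
  refine this.congr fun k => ?_
  rw [← norm_div]
  congr 1
  have h1 := one_sub_pow_succ_ne_zero hq0 hq1 k
  rw [qPoch_succ, Nat.choose_succ_succ' k 1, Nat.choose_one_right]
  have := hne k
  field_simp
  ring

/-! ### The entire function in the variables `w = x²`, `t = q^ν` -/

/-- `(qw;q)_∞ ₁φ₁(0; qw; q, tqw)`; one has `x^{-ν} j_ν(x;q) = jSeries q (q^ν) (x²)`. -/
noncomputable def jSeries (q t : ℝ) (w : ℂ) : ℂ := phi11Reg q 0 (q * w) (t * q * w)

/-- The general term of `jSeries`. -/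
noncomputable def jTerm (q t : ℝ) (w : ℂ) (k : ℕ) : ℂ :=
  (-1) ^ k * qPochInf q (q * w * q ^ k) * ((q : ℂ) ^ k.choose 2 / qPoch q q k * (t * q * w) ^ k)

theorem jSeries_eq_tsum (q t : ℝ) (w : ℂ) : jSeries q t w = ∑' k, jTerm q t w k := by
  unfold jSeries phi11Reg jTerm
  refine tsum_congr fun k => ?_
  simp only [qPoch, zero_mul, sub_zero, Finset.prod_const_one, one_mul]
  ring

theorem jEntire_eq_jSeries {q : ℝ} (hq0 : 0 < q) (ν : ℝ) (x : ℂ) :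
    jEntire q ν x = jSeries q (q ^ ν) (x ^ 2) := by
  unfold jEntire jSeries
  rw [Real.rpow_add_one hq0.ne']
  push_cast
  rfl

/-- The majorant for the Weierstrass test on a disc, from which `jSeries` is entire. The points `q w
q^k` stay in the disc of radius `R`, so one bound `C` on the infinite product serves all `k`. -/
theorem exists_norm_jTerm_le {q : ℝ} (hq0 : 0 < q) (hq1 : q < 1) (t : ℝ) (R : ℝ) :
    ∃ u : ℕ → ℝ, Summable u ∧ ∀ k w, ‖w‖ ≤ R → ‖jTerm q t w k‖ ≤ u k := by
  have hq : ‖(q : ℂ)‖ < 1 := by simpa [abs_of_pos hq0] using hq1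
  obtain ⟨C, hC⟩ := (isCompact_closedBall (0 : ℂ) R).exists_bound_of_continuousOn
    (differentiable_qPochInf hq).continuous.continuousOn
  refine ⟨fun k => C * ‖(q : ℂ) ^ k.choose 2 / qPoch q q k * (t * q * R : ℂ) ^ k‖,
    (summable_pow_choose_div_qPoch hq0 hq1 _).norm.mul_left C, fun k w hw => ?_⟩
  have hR : 0 ≤ R := (norm_nonneg w).trans hw
  have h1 : ‖qPochInf q (q * w * q ^ k)‖ ≤ C := by
    refine hC _ ?_
    rw [mem_closedBall_zero_iff, norm_mul, norm_mul, norm_pow]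
    calc ‖(q : ℂ)‖ * ‖w‖ * ‖(q : ℂ)‖ ^ k ≤ 1 * R * 1 := by
          gcongr
          exact pow_le_one₀ (norm_nonneg _) hq.le
      _ = R := by ring
  unfold jTerm
  rw [norm_mul, norm_mul, norm_pow, norm_neg, norm_one, one_pow, one_mul]
  refine mul_le_mul h1 ?_ (norm_nonneg _) ((norm_nonneg _).trans h1)
  simp only [norm_mul, norm_pow, norm_real, Real.norm_of_nonneg hR]
  gcongr

theorem summable_jTerm {q : ℝ} (hq0 : 0 < q) (hq1 : q < 1) (t : ℝ) (w : ℂ) :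
    Summable (jTerm q t w) := by
  obtain ⟨u, hu, h⟩ := exists_norm_jTerm_le hq0 hq1 t ‖w‖
  exact .of_norm_bounded hu fun k => h k w le_rfl

theorem differentiable_jSeries {q : ℝ} (hq0 : 0 < q) (hq1 : q < 1) (t : ℝ) :
    Differentiable ℂ (jSeries q t) := by
  intro w
  have hq : ‖(q : ℂ)‖ < 1 := by simpa [abs_of_pos hq0] using hq1
  obtain ⟨u, hu, h⟩ := exists_norm_jTerm_le hq0 hq1 t (‖w‖ + 1)
  have hd := differentiableOn_tsum_of_summable_norm (F := fun k w => jTerm q t w k) hu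
    (fun k => by
      have := (differentiable_qPochInf hq).comp
        (f := fun w : ℂ => (q : ℂ) * w * (q : ℂ) ^ k) (by fun_prop)
      exact ((this.const_mul _).mul (by fun_prop)).differentiableOn) (Metric.isOpen_ball (x := (0 : ℂ)) (ε := ‖w‖ + 1))
    (fun k z hz => h k z (by simpa using (mem_ball_zero_iff.1 hz).le))
  have := hd.differentiableAt (Metric.isOpen_ball.mem_nhds (x := w) (by simp))
  exact this.congr_of_eventuallyEq (.of_forall fun z => jSeries_eq_tsum q t z)

theorem jSeries_zero (q t : ℝ) : jSeries q t 0 = 1 := by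
  unfold jSeries phi11Reg
  rw [tsum_eq_single 0 (by intro k hk; simp [hk])]
  simp [qPoch, qPochInf]

theorem conj_jSeries {q : ℝ} (hq0 : 0 < q) (hq1 : q < 1) (t : ℝ) (w : ℂ) :
    (starRingEnd ℂ) (jSeries q t w) = jSeries q t ((starRingEnd ℂ) w) := by
  rw [jSeries_eq_tsum, jSeries_eq_tsum, conj_tsum]
  refine tsum_congr fun k => ?_
  simp [jTerm, conj_qPochInf hq0 hq1, conj_qPoch]

/-! ### Contiguous relations and the `q`-difference equation -/

/-- Contiguous relation in the parameter `t`. -/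
theorem jSeries_sub_jSeries_mul {q : ℝ} (hq0 : 0 < q) (hq1 : q < 1) (t : ℝ) (w : ℂ) :
    jSeries q t w - jSeries q (q * t) w = -(t * q * w) * jSeries q t (q * w) := by
  simp only [jSeries_eq_tsum]
  rw [← (summable_jTerm hq0 hq1 t w).tsum_sub (summable_jTerm hq0 hq1 (q * t) w),
    ((summable_jTerm hq0 hq1 t w).sub (summable_jTerm hq0 hq1 (q * t) w)).tsum_eq_zero_add,
    ← tsum_mul_left]
  -- The terms of index `k` differ by a factor `1 - q^k`, which kills `k = 0` and cancels the last
  -- factor of `(q;q)_k` otherwise; hence the index shift.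
  have h0 : jTerm q t w 0 - jTerm q (q * t) w 0 = 0 := by simp [jTerm]
  rw [h0, zero_add]
  refine tsum_congr fun k => ?_
  have h1 := one_sub_pow_succ_ne_zero hq0 hq1 k
  have h2 := qPoch_self_ne_zero hq0 hq1 k
  have e : (q : ℂ) * (q * w) * q ^ k = q * w * q ^ (k + 1) := by ring
  unfold jTerm
  rw [qPoch_succ, Nat.choose_succ_succ' k 1, Nat.choose_one_right, e]
  push_cast
  field_simp
  ring

/-- Contiguous relation in the argument `w`. -/
theorem jSeries_mul_sub_jSeries {q : ℝ} (hq0 : 0 < q) (hq1 : q < 1) (t : ℝ) (w : ℂ) :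
    jSeries q (q * t) w - jSeries q t (q * w) = -(q * w) * jSeries q (q * t) (q * w) := by
  have hq : ‖(q : ℂ)‖ < 1 := by simpa [abs_of_pos hq0] using hq1
  simp only [jSeries_eq_tsum]
  rw [← (summable_jTerm hq0 hq1 (q * t) w).tsum_sub (summable_jTerm hq0 hq1 t (q * w)),
    ← tsum_mul_left]
  refine tsum_congr fun k => ?_
  unfold jTerm
  have e : (q : ℂ) * (q * w) * q ^ k = q * w * q ^ k * q := by ring
  -- Splitting off the first factor of the product leaves `1 - q w q^k - 1`; its `q^k` turns `t^k`
  -- into `(qt)^k`.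
  rw [qPochInf_eq_one_sub_mul hq (q * w * q ^ k), e]
  push_cast
  ring

/-- The three-term `q`-difference equation in `w`. -/
theorem jSeries_recurrence {q : ℝ} (hq0 : 0 < q) (hq1 : q < 1) (t : ℝ) (w : ℂ) :
    jSeries q t w = (1 - (1 + t) * q * w) * jSeries q t (q * w)
      - t * q ^ 3 * w ^ 2 * jSeries q t (q * (q * w)) := by
  have h1 := jSeries_sub_jSeries_mul hq0 hq1 t w
  have h2 := jSeries_mul_sub_jSeries hq0 hq1 t w
  have h3 := jSeries_sub_jSeries_mul hq0 hq1 t (q * w)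
  linear_combination h1 + h2 + q * w * h3

/-! ### Reality of the zeros -/

/-- Backward induction from infinity: applied along `q^m w`, it carries a property from a
neighbourhood of `0` back to `w`. -/
theorem zero_of_eventually_of_succ {P : ℕ → Prop} (h : ∀ᶠ m in atTop, P m)
    (hs : ∀ m, P (m + 1) → P m) : P 0 := by
  obtain ⟨N, hN⟩ := h.exists
  induction N with
  | zero => exact hN
  | succ n ih => exact ih (hs n hN)

theorem tendsto_jSeries_pow_mul {q : ℝ} (hq0 : 0 < q) (hq1 : q < 1) (t : ℝ) (w : ℂ) :
    Tendsto (fun m : ℕ => jSeries q t ((q : ℂ) ^ m * w)) atTop (𝓝 1) := by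
  have hp : Tendsto (fun k : ℕ => (q : ℂ) ^ k * w) atTop (𝓝 0) := by
    simpa using (tendsto_pow_atTop_nhds_zero_of_norm_lt_one
      (x := (q : ℂ)) (by simpa [abs_of_pos hq0] using hq1)).mul_const w
  have := ((differentiable_jSeries hq0 hq1 t).continuous.tendsto 0).comp hp
  rwa [jSeries_zero] at this

/-- Nonreal points are not zeros: a Lagrange identity for the `q`-difference equation. -/
theorem im_eq_zero_of_jSeries_eq_zero {q : ℝ} (hq0 : 0 < q) (hq1 : q < 1) {t : ℝ} (ht : 0 < t)
    {w : ℂ} (hw : jSeries q t w = 0) : w.im = 0 := by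
  by_contra him
  let g : ℕ → ℂ := fun m => jSeries q t ((q : ℂ) ^ m * w)
  have hg : ∀ m, g m = (1 - ((1 + t) * q ^ (m + 1) : ℝ) * w) * g (m + 1)
      - (t * q ^ (2 * m + 3) : ℝ) * w ^ 2 * g (m + 2) := by
    intro m
    have h := jSeries_recurrence hq0 hq1 t ((q : ℂ) ^ m * w)
    have e1 : (q : ℂ) * ((q : ℂ) ^ m * w) = (q : ℂ) ^ (m + 1) * w := by ring
    have e2 : (q : ℂ) * ((q : ℂ) ^ (m + 1) * w) = (q : ℂ) ^ (m + 2) * w := by ring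
    rw [e1, e2] at h
    simp only [g]
    rw [h]
    push_cast
    ring
  let e : ℕ → ℝ := fun m => (g m * (starRingEnd ℂ) (w * g (m + 1))).im
  have he : ∀ m, e m = -w.im * normSq (g (m + 1)) +
      t * q ^ (2 * m + 3) * normSq w * e (m + 1) := by
    intro m
    simp only [e]
    rw [hg m]
    generalize g (m + 1) = G, g (m + 2) = H, (1 + t) * q ^ (m + 1) = s, t * q ^ (2 * m + 3) = p
    simp only [mul_im, mul_re, sub_im, sub_re, conj_re, conj_im, one_re, one_im, ofReal_re,
      ofReal_im, normSq_apply, pow_two]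
    ring
  -- The factor `-w.im` makes the limit a positive square, which treats both half-planes at once.
  have hlim : Tendsto (fun m => e m * -w.im) atTop (𝓝 (w.im ^ 2)) := by
    have hg1 := tendsto_jSeries_pow_mul hq0 hq1 t w
    have h2 := (continuous_im.tendsto _).comp (hg1.mul ((continuous_conj.tendsto _).comp
      (((tendsto_add_atTop_iff_nat 1).2 hg1).const_mul w)))
    have h3 : Tendsto e atTop (𝓝 (-w.im)) := by
      have : (1 * (starRingEnd ℂ) (w * 1)).im = -w.im := by simp
      rw [← this]
      exact h2
    have h4 := h3.mul_const (-w.im)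
    rwa [neg_mul_neg, ← pow_two] at h4
  have h0 : 0 < e 0 * -w.im := by
    refine zero_of_eventually_of_succ (P := fun m => 0 < e m * -w.im)
      (hlim.eventually_const_lt (by positivity)) fun m hm => ?_
    have h1 : e m * -w.im = w.im ^ 2 * normSq (g (m + 1)) +
        t * q ^ (2 * m + 3) * normSq w * (e (m + 1) * -w.im) := by rw [he m]; ring
    have h2 : 0 < normSq w := normSq_pos.2 fun h => him (by simp [h])
    have h3 : 0 < t * q ^ (2 * m + 3) * normSq w * (e (m + 1) * -w.im) := by positivity
    have h4 : 0 ≤ w.im ^ 2 * normSq (g (m + 1)) := mul_nonneg (sq_nonneg _) (normSq_nonneg _)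
    rw [h1]
    linarith
  have : e 0 = 0 := by simp [e, g, hw]
  simp [this] at h0

/-! ### The real restriction: Wronskian, signs and large zeros -/

/-- The restriction of `jSeries` to the real axis. -/
noncomputable def jReal (q t y : ℝ) : ℝ := (jSeries q t y).re

theorem ofReal_jReal {q : ℝ} (hq0 : 0 < q) (hq1 : q < 1) (t y : ℝ) :
    (jReal q t y : ℂ) = jSeries q t y := by
  have h := conj_jSeries hq0 hq1 t y
  rw [conj_ofReal] at h
  exact conj_eq_iff_re.1 h

theorem jReal_zero (q t : ℝ) : jReal q t 0 = 1 := by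
  simp [jReal, jSeries_zero]

theorem contDiff_jReal {q : ℝ} (hq0 : 0 < q) (hq1 : q < 1) (t : ℝ) :
    ContDiff ℝ 1 (jReal q t) :=
  (differentiable_jSeries hq0 hq1 t).contDiff.real_of_complex

theorem hasDerivAt_jReal {q : ℝ} (hq0 : 0 < q) (hq1 : q < 1) (t y : ℝ) :
    HasDerivAt (jReal q t) (deriv (jReal q t) y) y :=
  ((contDiff_jReal hq0 hq1 t).differentiable one_ne_zero y).hasDerivAt

theorem hasDerivAt_jReal_mul {q : ℝ} (hq0 : 0 < q) (hq1 : q < 1) (t c y : ℝ) :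
    HasDerivAt (fun y => jReal q t (c * y)) (deriv (jReal q t) (c * y) * c) y :=
  (hasDerivAt_jReal hq0 hq1 t (c * y)).comp y (by simpa using (hasDerivAt_id y).const_mul c)

theorem jReal_recurrence {q : ℝ} (hq0 : 0 < q) (hq1 : q < 1) (t y : ℝ) :
    jReal q t y = (1 - (1 + t) * q * y) * jReal q t (q * y)
      - t * q ^ 3 * y ^ 2 * jReal q t (q ^ 2 * y) := by
  have h := jSeries_recurrence hq0 hq1 t (y : ℂ)
  rw [← ofReal_mul, ← ofReal_mul, ← ofReal_jReal hq0 hq1, ← ofReal_jReal hq0 hq1,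
    ← ofReal_jReal hq0 hq1] at h
  rw [show q ^ 2 * y = q * (q * y) by ring]
  exact_mod_cast h

theorem jReal_mul_param {q : ℝ} (hq0 : 0 < q) (hq1 : q < 1) (t y : ℝ) :
    jReal q (q * t) y = jReal q t y + t * q * y * jReal q t (q * y) := by
  have h := jSeries_sub_jSeries_mul hq0 hq1 t (y : ℂ)
  rw [← ofReal_mul q y, ← ofReal_jReal hq0 hq1, ← ofReal_jReal hq0 hq1,
    ← ofReal_jReal hq0 hq1] at h
  have h' : jReal q t y - jReal q (q * t) y = -(t * q * y) * jReal q t (q * y) := by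
    exact_mod_cast h
  linarith

theorem deriv_jReal_recurrence {q : ℝ} (hq0 : 0 < q) (hq1 : q < 1) (t y : ℝ) :
    deriv (jReal q t) y = -((1 + t) * q) * jReal q t (q * y)
      + (1 - (1 + t) * q * y) * (deriv (jReal q t) (q * y) * q)
      - (2 * t * q ^ 3 * y * jReal q t (q ^ 2 * y)
        + t * q ^ 3 * y ^ 2 * (deriv (jReal q t) (q ^ 2 * y) * q ^ 2)) := by
  have h1 : HasDerivAt (fun y : ℝ => 1 - (1 + t) * q * y) (-((1 + t) * q)) y := by
    simpa using ((hasDerivAt_id y).const_mul ((1 + t) * q)).const_sub 1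
  have h2 : HasDerivAt (fun y : ℝ => t * q ^ 3 * y ^ 2) (2 * t * q ^ 3 * y) y :=
    ((hasDerivAt_pow 2 y).const_mul (t * q ^ 3)).congr_deriv (by norm_num; ring)
  have h := (h1.mul (hasDerivAt_jReal_mul hq0 hq1 t q y)).sub
    (h2.mul (hasDerivAt_jReal_mul hq0 hq1 t (q ^ 2) y))
  refine (hasDerivAt_jReal hq0 hq1 t y).unique (h.congr_of_eventuallyEq ?_)
  exact .of_forall fun z => jReal_recurrence hq0 hq1 t z

/-- The Wronskian of `y ↦ jReal q t y` and `y ↦ y * jReal q t (q * y)` is positive. -/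
theorem jReal_wronskian_pos {q : ℝ} (hq0 : 0 < q) (hq1 : q < 1) {t : ℝ} (ht : 0 < t) (y : ℝ) :
    0 < jReal q t y * (jReal q t (q * y) + y * (deriv (jReal q t) (q * y) * q))
      - deriv (jReal q t) y * (y * jReal q t (q * y)) := by
  rcases eq_or_ne y 0 with rfl | hy
  · simp [jReal_zero]
  let V : ℝ → ℝ := fun y => jReal q t y * (jReal q t (q * y) + y * (deriv (jReal q t) (q * y) * q))
      - deriv (jReal q t) y * (y * jReal q t (q * y))
  -- The recurrence and its derivative express the Wronskian at `y` by a square plus a nonnegative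
  -- multiple of itself at `qy`.
  have hV : ∀ y, V y = jReal q t (q * y) ^ 2 + t * q ^ 3 * y ^ 2 * V (q * y) := by
    intro y
    simp only [V]
    rw [jReal_recurrence hq0 hq1 t y, deriv_jReal_recurrence hq0 hq1 t y,
      show q * (q * y) = q ^ 2 * y by ring]
    ring
  have hc : Continuous V := by
    have h1 := (contDiff_jReal hq0 hq1 t).continuous
    have h2 := (contDiff_jReal hq0 hq1 t).continuous_deriv le_rfl
    fun_prop
  have hV0 : V 0 = 1 := by simp [V, jReal_zero]
  have hp : Tendsto (fun m : ℕ => q ^ m * y) atTop (𝓝 0) := by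
    simpa using (tendsto_pow_atTop_nhds_zero_of_lt_one hq0.le hq1).mul_const y
  have hlim := (hc.tendsto 0).comp hp
  rw [hV0] at hlim
  have h0 : 0 < V (q ^ 0 * y) := by
    refine zero_of_eventually_of_succ (P := fun m => 0 < V (q ^ m * y))
      (hlim.eventually_const_lt zero_lt_one) fun m hm => ?_
    have e : q * (q ^ m * y) = q ^ (m + 1) * y := by ring
    rw [hV, e]
    positivity
  simpa [V] using h0

theorem jReal_pos_of_nonpos {q : ℝ} (hq0 : 0 < q) (hq1 : q < 1) {t : ℝ} (ht : 0 < t) {y : ℝ}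
    (hy : y ≤ 0) : 0 < jReal q t y := by
  let g : ℕ → ℝ := fun m => jReal q t (q ^ m * y)
  have hp : Tendsto (fun m : ℕ => q ^ m * y) atTop (𝓝 0) := by
    simpa using (tendsto_pow_atTop_nhds_zero_of_lt_one hq0.le hq1).mul_const y
  have hg : Tendsto g atTop (𝓝 1) := by
    have := ((contDiff_jReal hq0 hq1 t).continuous.tendsto 0).comp hp
    rwa [jReal_zero] at this
  have hlim : Tendsto (fun m => g m - t * q * (q ^ m * -y) * g (m + 1)) atTop (𝓝 1) := by
    have := hg.sub (((hp.neg.const_mul (t * q))).mul ((tendsto_add_atTop_iff_nat 1).2 hg))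
    simpa using this
  -- The second quantity is `jReal q (q * t)` at `q^m y`. For `y ≤ 0` both contiguous relations have
  -- nonnegative coefficients, so the two positivities propagate together, though the three-term
  -- recurrence alone has a negative coefficient.
  have h0 : 0 < g 0 ∧ 0 < g 0 - t * q * (q ^ 0 * -y) * g (0 + 1) := by
    refine zero_of_eventually_of_succ
      (P := fun m => 0 < g m ∧ 0 < g m - t * q * (q ^ m * -y) * g (m + 1))
      ((hg.eventually_const_lt zero_lt_one).and (hlim.eventually_const_lt zero_lt_one))
      fun m ⟨h1, h2⟩ => ?_
    have hr : g m = (1 + (1 + t) * q * (q ^ m * -y)) * g (m + 1)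
        - t * q ^ 3 * (q ^ m * -y) ^ 2 * g (m + 2) := by
      have h := jReal_recurrence hq0 hq1 t (q ^ m * y)
      have e1 : q * (q ^ m * y) = q ^ (m + 1) * y := by ring
      have e2 : q ^ 2 * (q ^ m * y) = q ^ (m + 2) * y := by ring
      rw [e1, e2] at h
      simp only [g]
      rw [h]
      ring
    have hz : 0 ≤ q ^ m * -y := mul_nonneg (by positivity) (by linarith)
    set z := q ^ m * -y
    have e : q ^ (m + 1) * -y = q * z := by simp only [z]; ring
    rw [e] at h2
    have h4 : 0 < g m - t * q * z * g (m + 1) := by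
      have h5 : g m - t * q * z * g (m + 1) =
          g (m + 1) + q * z * (g (m + 1) - t * q * (q * z) * g (m + 1 + 1)) := by
        rw [hr]; ring
      have h6 : 0 ≤ q * z * (g (m + 1) - t * q * (q * z) * g (m + 1 + 1)) := by positivity
      rw [h5]
      linarith
    have h7 : 0 ≤ t * q * z * g (m + 1) := by positivity
    exact ⟨by linarith, h4⟩
  simpa [g] using h0.1

theorem exists_zero_of_mul_nonpos {f : ℝ → ℝ} (hf : Continuous f) {a b : ℝ} (hab : a ≤ b)
    (h : f a * f b ≤ 0) : ∃ c, a ≤ c ∧ c ≤ b ∧ f c = 0 := by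
  have h0 : (0 : ℝ) ∈ Set.uIcc (f a) (f b) := by
    rw [Set.mem_uIcc]
    rcases mul_nonpos_iff.1 h with h | h
    · exact .inr ⟨h.2, h.1⟩
    · exact .inl h
  obtain ⟨c, hc, hc0⟩ := intermediate_value_uIcc hf.continuousOn h0
  rw [Set.uIcc_of_le hab] at hc
  exact ⟨c, hc.1, hc.2, hc0⟩

theorem exists_jReal_eq_zero_gt {q : ℝ} (hq0 : 0 < q) (hq1 : q < 1) {t : ℝ} (ht : 0 < t) (R : ℝ) :
    ∃ y, R < y ∧ jReal q t y = 0 := by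
  have hc := (contDiff_jReal hq0 hq1 t).continuous
  obtain ⟨y, hy0, hyR, hy1⟩ : ∃ y, 0 < y ∧ R < q ^ 2 * y ∧ 1 ≤ (1 + t) * q * y := by
    have h1 : ∀ᶠ y : ℝ in atTop, R < q ^ 2 * y :=
      (tendsto_id.const_mul_atTop (by positivity)).eventually_gt_atTop R
    have h2 : ∀ᶠ y : ℝ in atTop, 1 ≤ (1 + t) * q * y :=
      (tendsto_id.const_mul_atTop (by positivity)).eventually_ge_atTop 1
    obtain ⟨y, h⟩ := ((eventually_gt_atTop 0).and (h1.and h2)).exists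
    exact ⟨y, h.1, h.2.1, h.2.2⟩
  have hle1 : q * y ≤ y := by nlinarith
  have hle2 : q ^ 2 * y ≤ q * y := by nlinarith [mul_pos hq0 hy0]
  by_cases hs : jReal q t (q ^ 2 * y) * jReal q t (q * y) ≤ 0
  · obtain ⟨c, h1, -, h3⟩ := exists_zero_of_mul_nonpos hc hle2 hs
    exact ⟨c, hyR.trans_le h1, h3⟩
  -- Once `(1 + t)qy ≥ 1`, equal signs at `q²y` and `qy` force a sign change or a zero between `qy`
  -- and `y`.
  · have : jReal q t (q * y) * jReal q t y ≤ 0 := by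
      have e : jReal q t (q * y) * jReal q t y = -(((1 + t) * q * y - 1) * jReal q t (q * y) ^ 2
          + t * q ^ 3 * y ^ 2 * (jReal q t (q ^ 2 * y) * jReal q t (q * y))) := by
        rw [jReal_recurrence hq0 hq1 t y]; ring
      push Not at hs
      have h1 : 0 ≤ (1 + t) * q * y - 1 := by linarith
      rw [e, neg_nonpos]
      positivity
    obtain ⟨c, h1, -, h3⟩ := exists_zero_of_mul_nonpos hc hle1 this
    exact ⟨c, (hyR.trans_le hle2).trans_le h1, h3⟩

theorem jSeries_eq_zero_iff {q : ℝ} (hq0 : 0 < q) (hq1 : q < 1) {t : ℝ} (ht : 0 < t) (w : ℂ) :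
    jSeries q t w = 0 ↔ ∃ y : ℝ, 0 < y ∧ w = y ∧ jReal q t y = 0 := by
  constructor
  · intro h
    have him := im_eq_zero_of_jSeries_eq_zero hq0 hq1 ht h
    have hw : w = (w.re : ℂ) := by apply Complex.ext <;> simp [him]
    have h0 : jReal q t w.re = 0 := by rw [jReal, ← hw, h, zero_re]
    refine ⟨w.re, ?_, hw, h0⟩
    by_contra hn
    exact (jReal_pos_of_nonpos hq0 hq1 ht (not_lt.1 hn)).ne' h0
  · rintro ⟨y, -, rfl, h⟩
    rw [← ofReal_jReal hq0 hq1, h, ofReal_zero]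

/-! ### Enumeration and Sturm interlacing -/

/-- Finite initial pieces give a least element and local finiteness, and unboundedness excludes a
maximum; such a linear order is isomorphic to `ℕ`. -/
theorem exists_strictMono_range_eq {S : Set ℝ} (hfin : ∀ R, (S ∩ Set.Iic R).Finite)
    (hunb : ∀ R, ∃ x ∈ S, R < x) : ∃ a : ℕ → ℝ, StrictMono a ∧ Set.range a = S := by
  classical
  obtain ⟨x₀, hx₀, -⟩ := hunb 0
  obtain ⟨m, hm, hmin⟩ := (hfin x₀).exists_minimalFor id _ ⟨x₀, hx₀, Set.self_mem_Iic⟩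
  let hbot : OrderBot S :=
    { bot := ⟨m, hm.1⟩
      bot_le := fun x => by
        change m ≤ x
        by_contra! hlt
        exact hlt.not_ge (hmin ⟨x.2, hlt.le.trans hm.2⟩ hlt.le) }
  let hloc : LocallyFiniteOrder S := LocallyFiniteOrder.ofFiniteIcc fun x y =>
    Set.Finite.of_finite_image ((hfin y).subset (by
      rintro _ ⟨z, hz, rfl⟩
      exact ⟨z.2, hz.2⟩)) Subtype.val_injective.injOn
  have hmax : NoMaxOrder S := ⟨fun x => by
    obtain ⟨y, hy, hxy⟩ := hunb x
    exact ⟨⟨y, hy⟩, hxy⟩⟩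
  let _ : SuccOrder S := LinearLocallyFiniteOrder.succOrder S
  let _ : PredOrder S := LinearLocallyFiniteOrder.predOrder S
  let e : S ≃o ℕ := orderIsoNatOfLinearSuccPredArch
  refine ⟨fun n => e.symm n, fun i j hij => e.symm.strictMono hij, ?_⟩
  ext x
  constructor
  · rintro ⟨n, rfl⟩
    exact (e.symm n).2
  · intro hx
    exact ⟨e ⟨x, hx⟩, by simp⟩

section Wronskian

variable {u v u' v' : ℝ → ℝ}

/-- Between two zeros of `u` there is a zero of `v` when the Wronskian does not vanish. -/
theorem exists_zero_between_of_wronskian_ne_zero {x y : ℝ} (hxy : x < y)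
    (hu : ∀ z ∈ Set.Icc x y, HasDerivAt u (u' z) z) (hv : ∀ z ∈ Set.Icc x y, HasDerivAt v (v' z) z)
    (hW : ∀ z ∈ Set.Icc x y, u z * v' z - u' z * v z ≠ 0) (hx : u x = 0) (hy : u y = 0) :
    ∃ z ∈ Set.Ioo x y, v z = 0 := by
  by_contra! hne
  have hv0 : ∀ z ∈ Set.Icc x y, v z ≠ 0 := by
    intro z hz h0
    rcases eq_or_lt_of_le hz.1 with rfl | h1
    · exact hW _ hz (by simp [hx, h0])
    rcases eq_or_lt_of_le hz.2 with rfl | h2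
    · exact hW _ hz (by simp [hy, h0])
    exact hne z ⟨h1, h2⟩ h0
  -- Rolle's theorem for `u / v`, whose derivative is minus the Wronskian over `v²`.
  have hd : ∀ z ∈ Set.Icc x y,
      HasDerivAt (fun z => u z / v z) ((u' z * v z - u z * v' z) / v z ^ 2) z :=
    fun z hz => (hu z hz).div (hv z hz) (hv0 z hz)
  obtain ⟨c, hc, hc0⟩ := exists_hasDerivAt_eq_zero hxy
    (fun z hz => (hd z hz).continuousAt.continuousWithinAt) (by simp [hx, hy])
    (fun z hz => hd z (Set.Ioo_subset_Icc_self hz))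
  have hcI := Set.Ioo_subset_Icc_self hc
  rw [div_eq_zero_iff, or_iff_left (pow_ne_zero 2 (hv0 c hcI))] at hc0
  exact hW c hcI (by linarith)

/-- Infinitely many zeros in `[0, R]` would accumulate at a zero, which is not `0` and, being
simple, is isolated. -/
theorem finite_zeros_inter_Iic (hu : ∀ x, HasDerivAt u (u' x) x) (h0 : u 0 ≠ 0)
    (hsimple : ∀ x, 0 < x → u x = 0 → u' x ≠ 0) (R : ℝ) :
    ({x | 0 < x ∧ u x = 0} ∩ Set.Iic R).Finite := by
  by_contra hinf
  have hinf : Set.Infinite _ := hinf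
  obtain ⟨p, hpK, hp⟩ := hinf.exists_accPt_of_subset_isCompact (isCompact_Icc (a := 0) (b := R))
    (fun x hx => ⟨hx.1.1.le, hx.2⟩)
  rw [accPt_iff_frequently_nhdsNE] at hp
  have hz : ∃ᶠ x in 𝓝[≠] p, u x = 0 := hp.mono fun x hx => hx.1.2
  have hup : u p = 0 := by
    have hcl : IsClosed {x | u x = 0} := isClosed_eq
      (continuous_iff_continuousAt.2 fun x => (hu x).continuousAt) continuous_const
    exact hcl.mem_of_frequently_of_tendsto (hz.filter_mono nhdsWithin_le_nhds) tendsto_id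
  have hp0 : 0 < p := lt_of_le_of_ne hpK.1 (by rintro rfl; exact h0 hup)
  exact hz ((hu p).eventually_ne (hsimple p hp0 hup))

/-- If `u v' - u' v > 0` on `(0, ∞)` and the positive zeros of `u` are unbounded, the positive
zeros of `u` and `v` interlace, starting with a zero of `u`. -/
theorem exists_interlacing_of_wronskian_pos (hu : ∀ x, HasDerivAt u (u' x) x)
    (hv : ∀ x, HasDerivAt v (v' x) x) (hW : ∀ x, 0 < x → 0 < u x * v' x - u' x * v x)
    (hu0 : 0 < u 0) (hv0 : 0 < v 0) (hunb : ∀ R, ∃ x, R < x ∧ u x = 0) :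
    ∃ a b : ℕ → ℝ, StrictMono a ∧ StrictMono b ∧ Set.range a = {x | 0 < x ∧ u x = 0} ∧
      Set.range b = {x | 0 < x ∧ v x = 0} ∧ ∀ n, a n < b n ∧ b n < a (n + 1) := by
  have hsimple : ∀ x, 0 < x → u x = 0 → u' x ≠ 0 := by
    intro x hx h h'
    have := hW x hx
    simp [h, h'] at this
  have hfin := finite_zeros_inter_Iic hu hu0.ne' hsimple
  obtain ⟨a, ha, hra⟩ := exists_strictMono_range_eq hfin fun R => by
    obtain ⟨x, hx, hx0⟩ := hunb (max R 0)
    exact ⟨x, ⟨(le_max_right _ _).trans_lt hx, hx0⟩, (le_max_left _ _).trans_lt hx⟩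
  have haz : ∀ n, 0 < a n ∧ u (a n) = 0 := fun n => by
    have : a n ∈ {x | 0 < x ∧ u x = 0} := hra ▸ Set.mem_range_self n
    exact this
  have hnot : ∀ n x, a n < x → x < a (n + 1) → u x ≠ 0 := by
    intro n x h1 h2 hx
    obtain ⟨k, rfl⟩ : x ∈ Set.range a := hra ▸ ⟨(haz n).1.trans h1, hx⟩
    have := ha.lt_iff_lt.1 h1
    have := ha.lt_iff_lt.1 h2
    omega
  have hex : ∀ n, ∃ z ∈ Set.Ioo (a n) (a (n + 1)), v z = 0 := fun n =>
    exists_zero_between_of_wronskian_ne_zero (ha n.lt_succ_self) (fun z _ => hu z)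
      (fun z _ => hv z) (fun z hz => (hW z ((haz n).1.trans_le hz.1)).ne') (haz n).2 (haz _).2
  choose b hb hvb using hex
  have hbm : StrictMono b := strictMono_nat_of_lt_succ fun n => (hb n).2.trans (hb (n + 1)).1
  refine ⟨a, b, ha, hbm, hra, ?_, fun n => ⟨(hb n).1, (hb n).2⟩⟩
  -- Before the first zero of `u` the quotient `v / u` increases from a positive value, so `v`
  -- cannot vanish there.
  have hfirst : ∀ y, 0 < y → v y = 0 → a 0 < y := by
    intro y hy hvy
    by_contra! hle
    have hlt : y < a 0 := lt_of_le_of_ne hle (by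
      rintro rfl
      have := hW _ hy
      simp [hvy, (haz 0).2] at this)
    have hune : ∀ z ∈ Set.Icc 0 y, u z ≠ 0 := by
      intro z hz h
      rcases eq_or_lt_of_le hz.1 with rfl | hz0
      · exact hu0.ne' h
      obtain ⟨k, rfl⟩ : z ∈ Set.range a := hra ▸ ⟨hz0, h⟩
      exact ((ha.monotone (Nat.zero_le k)).trans hz.2).not_gt hlt
    have hd : ∀ z ∈ Set.Icc 0 y,
        HasDerivAt (fun z => v z / u z) ((v' z * u z - v z * u' z) / u z ^ 2) z :=
      fun z hz => (hv z).div (hu z) (hune z hz)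
    have hmono : StrictMonoOn (fun z => v z / u z) (Set.Icc 0 y) := by
      refine strictMonoOn_of_deriv_pos (convex_Icc 0 y)
        (fun z hz => (hd z hz).continuousAt.continuousWithinAt) fun z hz => ?_
      rw [interior_Icc] at hz
      have hzI := Set.Ioo_subset_Icc_self hz
      rw [(hd z hzI).deriv]
      have h1 := hW z hz.1
      have h2 : 0 < u z ^ 2 := by have := hune z hzI; positivity
      exact div_pos (by linarith) h2
    have h := hmono (Set.left_mem_Icc.2 hy.le) (Set.right_mem_Icc.2 hy.le) hy
    simp only [hvy, zero_div] at h
    exact (div_pos hv0 hu0).not_gt h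
  ext y
  constructor
  · rintro ⟨n, rfl⟩
    exact ⟨(haz n).1.trans (hb n).1, hvb n⟩
  · rintro ⟨hy, hvy⟩
    have hbig : ∃ n, y ≤ a n := by
      obtain ⟨x, hx, hx0⟩ := hunb y
      obtain ⟨k, rfl⟩ : x ∈ Set.range a := hra ▸ ⟨hy.trans hx, hx0⟩
      exact ⟨k, hx.le⟩
    classical
    obtain ⟨n, hn⟩ : ∃ n, Nat.find hbig = n + 1 := Nat.exists_eq_succ_of_ne_zero fun h => by
      have := Nat.find_spec hbig
      rw [h] at this
      exact (hfirst y hy hvy).not_ge this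
    have h1 : a n < y := not_le.1 (Nat.find_min hbig (by omega))
    have h2 : y ≤ a (n + 1) := hn ▸ Nat.find_spec hbig
    -- Two zeros of `v` in `(a n, a (n + 1)]` would enclose a zero of `u` strictly between
    -- consecutive ones; hence `b n` is the only one.
    have hsq : ∀ p q, a n < p → p < q → q ≤ a (n + 1) → v p = 0 → v q = 0 → False := by
      intro p q hp hpq hq hvp hvq
      obtain ⟨z, hz, hz0⟩ := exists_zero_between_of_wronskian_ne_zero hpq (fun z _ => hv z)
        (fun z _ => hu z) (fun z hz => by
          have := hW z ((haz n).1.trans (hp.trans_le hz.1))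
          have h' : v z * u' z - v' z * u z < 0 := by linarith
          exact h'.ne) hvp hvq
      exact hnot n z (hp.trans hz.1) (hz.2.trans_le hq) hz0
    refine ⟨n, ?_⟩
    rcases lt_trichotomy (b n) y with h | h | h
    · exact (hsq _ _ (hb n).1 h h2 (hvb n) hvy).elim
    · exact h
    · exact (hsq _ _ h1 h (hb n).2.le hvy (hvb n)).elim

end Wronskian

/-! ### Return to the variable `x` and the index `ν` -/

theorem rpow_add_one_eq_mul {q : ℝ} (hq0 : 0 < q) (ν : ℝ) : q ^ (ν + 1) = q * q ^ ν := by
  rw [Real.rpow_add_one hq0.ne', mul_comm]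

theorem jEntire_eq_zero_iff {q : ℝ} (hq0 : 0 < q) (hq1 : q < 1) (ν : ℝ) (x : ℂ) :
    jEntire q ν x = 0 ↔ ∃ y : ℝ, 0 < y ∧ x ^ 2 = y ∧ jReal q (q ^ ν) y = 0 := by
  rw [jEntire_eq_jSeries hq0, jSeries_eq_zero_iff hq0 hq1 (Real.rpow_pos_of_pos hq0 ν)]

theorem jPosZeros_eq {q : ℝ} (hq0 : 0 < q) (hq1 : q < 1) (ν : ℝ) :
    jPosZeros q ν = {x | 0 < x ∧ jReal q (q ^ ν) (x ^ 2) = 0} := by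
  ext x
  refine and_congr_right fun hx => ?_
  rw [jEntire_eq_jSeries hq0, ← ofReal_pow, ← ofReal_jReal hq0 hq1, ofReal_eq_zero]

/-- By the contiguous relation in `t`, `J_{qt}(y)` is `J_t(y)` plus `tq` times `y J_t(qy)`. The
summand `J_t` contributes nothing, so this is `tq` times the Wronskian of `jReal_wronskian_pos`. -/
theorem jReal_wronskian_mul_param_pos {q : ℝ} (hq0 : 0 < q) (hq1 : q < 1) {t : ℝ} (ht : 0 < t)
    (y : ℝ) :
    0 < jReal q t y * deriv (jReal q (q * t)) y - deriv (jReal q t) y * jReal q (q * t) y := by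
  have hd : HasDerivAt (jReal q (q * t)) (deriv (jReal q t) y +
      (t * q * jReal q t (q * y) + t * q * y * (deriv (jReal q t) (q * y) * q))) y := by
    have h1 : HasDerivAt (fun y : ℝ => t * q * y) (t * q) y := by
      simpa using (hasDerivAt_id y).const_mul (t * q)
    exact ((hasDerivAt_jReal hq0 hq1 t y).add (h1.mul (hasDerivAt_jReal_mul hq0 hq1 t q y))
      ).congr_of_eventuallyEq (.of_forall fun z => jReal_mul_param hq0 hq1 t z)
  have hW := jReal_wronskian_pos hq0 hq1 ht y
  rw [hd.deriv, jReal_mul_param hq0 hq1]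
  have := mul_pos (mul_pos ht hq0) hW
  linarith

theorem differentiable_jEntire {q : ℝ} (hq0 : 0 < q) (hq1 : q < 1) (ν : ℝ) :
    Differentiable ℂ (jEntire q ν) := by
  have h : jEntire q ν = fun x => jSeries q (q ^ ν) (x ^ 2) :=
    funext (jEntire_eq_jSeries hq0 ν)
  rw [h]
  exact (differentiable_jSeries hq0 hq1 _).comp (differentiable_id.pow 2)

theorem im_eq_zero_of_sq_eq_ofReal {x : ℂ} {y : ℝ} (hy : 0 < y) (h : x ^ 2 = y) : x.im = 0 := by
  have h1 := congrArg re h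
  have h2 := congrArg im h
  simp only [pow_two, mul_re, mul_im, ofReal_re, ofReal_im] at h1 h2
  have h3 : x.re * x.im = 0 := by linarith
  rcases mul_eq_zero.1 h3 with h | h
  · rw [h] at h1
    nlinarith [mul_self_nonneg x.im]
  · exact h

theorem deriv_jEntire_ne_zero {q : ℝ} (hq0 : 0 < q) (hq1 : q < 1) (ν : ℝ) {x : ℂ}
    (hx : jEntire q ν x = 0) : deriv (jEntire q ν) x ≠ 0 := by
  have ht := Real.rpow_pos_of_pos hq0 ν
  obtain ⟨y, hy, hxy, h0⟩ := (jEntire_eq_zero_iff hq0 hq1 ν x).1 hx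
  have hf : jEntire q ν = fun x => jSeries q (q ^ ν) (x ^ 2) :=
    funext (jEntire_eq_jSeries hq0 ν)
  have hs := (differentiable_jSeries hq0 hq1 (q ^ ν) (x ^ 2)).hasDerivAt
  have hd := hs.comp x (hasDerivAt_pow 2 x)
  have hs' : deriv (jSeries q (q ^ ν)) (x ^ 2) ≠ 0 := by
    intro h
    rw [h, hxy] at hs
    have hr := hs.real_of_complex
    have hW := jReal_wronskian_mul_param_pos hq0 hq1 ht y
    have hz : deriv (jReal q (q ^ ν)) y = 0 := hr.deriv
    rw [h0, hz] at hW
    simp at hW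
  have hx0 : x ≠ 0 := by
    rintro rfl
    have : (y : ℂ) = 0 := by simpa using hxy.symm
    exact hy.ne' (ofReal_eq_zero.1 this)
  rw [hf]
  have e := hd.deriv
  simp only [Function.comp_def] at e
  rw [e]
  exact mul_ne_zero hs' (by simpa using hx0)

theorem jFun_eq_zero_iff (q ν : ℝ) {x : ℂ} (hx : x ≠ 0) : jFun q ν x = 0 ↔ jEntire q ν x = 0 := by
  simp [jFun, hx]

theorem jEntire_ne_zero_of_succ_eq_zero {q : ℝ} (hq0 : 0 < q) (hq1 : q < 1) (ν : ℝ) {x : ℂ}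
    (h : jEntire q (ν + 1) x = 0) : jEntire q ν x ≠ 0 := by
  intro h'
  obtain ⟨y, hy, hxy, h0⟩ := (jEntire_eq_zero_iff hq0 hq1 _ x).1 h
  obtain ⟨z, hz, hxz, h0'⟩ := (jEntire_eq_zero_iff hq0 hq1 _ x).1 h'
  obtain rfl : z = y := ofReal_injective (hxz.symm.trans hxy)
  have hW := jReal_wronskian_mul_param_pos hq0 hq1 (Real.rpow_pos_of_pos hq0 ν) z
  rw [rpow_add_one_eq_mul hq0] at h0
  simp [h0, h0'] at hW

theorem exists_jPosZeros_gt {q : ℝ} (hq0 : 0 < q) (hq1 : q < 1) (ν R : ℝ) :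
    ∃ x ∈ jPosZeros q ν, R < x := by
  obtain ⟨y, hy, h0⟩ :=
    exists_jReal_eq_zero_gt hq0 hq1 (Real.rpow_pos_of_pos hq0 ν) ((max R 0) ^ 2)
  have hy0 : 0 < y := (sq_nonneg _).trans_lt hy
  rw [jPosZeros_eq hq0 hq1]
  refine ⟨√y, ⟨Real.sqrt_pos.2 hy0, by rwa [Real.sq_sqrt hy0.le]⟩, ?_⟩
  exact (le_max_left R 0).trans_lt (Real.lt_sqrt_of_sq_lt hy)

theorem exists_jPosZeros_interlacing {q : ℝ} (hq0 : 0 < q) (hq1 : q < 1) (ν : ℝ) :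
    ∃ a b : ℕ → ℝ, StrictMono a ∧ StrictMono b ∧
      Set.range a = jPosZeros q ν ∧ Set.range b = jPosZeros q (ν + 1) ∧
      ∀ n, a n < b n ∧ b n < a (n + 1) := by
  have hd : ∀ t x : ℝ, HasDerivAt (fun x => jReal q t (x ^ 2))
      (deriv (jReal q t) (x ^ 2) * (2 * x)) x := fun t x => by
    have h := (hasDerivAt_jReal hq0 hq1 t (x ^ 2)).comp x (hasDerivAt_pow 2 x)
    exact h.congr_deriv (by simp)
  have h := exists_interlacing_of_wronskian_pos (hd (q ^ ν)) (hd (q ^ (ν + 1)))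
    (fun x hx => by
      have hW := jReal_wronskian_mul_param_pos hq0 hq1 (Real.rpow_pos_of_pos hq0 ν) (x ^ 2)
      rw [← rpow_add_one_eq_mul hq0] at hW
      -- Substituting `y = x²` multiplies the Wronskian by `2x`, positive for `x > 0`.
      have := mul_pos hW (mul_pos two_pos hx)
      linarith) (by simp [jReal_zero]) (by simp [jReal_zero])
    (fun R => by
      obtain ⟨x, hx, hR⟩ := exists_jPosZeros_gt hq0 hq1 ν R
      rw [jPosZeros_eq hq0 hq1] at hx
      exact ⟨x, hR, hx.2⟩)
  rwa [← jPosZeros_eq hq0 hq1, ← jPosZeros_eq hq0 hq1] at h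

theorem accPt_jZeros_iff {q : ℝ} (hq0 : 0 < q) (hq1 : q < 1) (ν : ℝ) (p : OnePoint ℂ) :
    AccPt p (𝓟 ((fun z : ℂ => (z : OnePoint ℂ)) '' jZeros q ν)) ↔ p = OnePoint.infty := by
  rw [accPt_iff_frequently_nhdsNE]
  induction p using OnePoint.rec with
  | infty =>
    simp only [iff_true]
    rw [OnePoint.nhdsNE_infty_eq, coclosedCompact_eq_cocompact, frequently_map,
      ← Metric.cobounded_eq_cocompact, (Metric.hasBasis_cobounded_compl_closedBall 0).frequently_iff]
    intro R _
    obtain ⟨x, hx, hR⟩ := exists_jPosZeros_gt hq0 hq1 ν R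
    refine ⟨x, ?_, x, hx.2, rfl⟩
    simpa [abs_of_pos hx.1] using hR
  | coe p =>
    simp only [OnePoint.coe_ne_infty, iff_false]
    have e : ((↑) : ℂ → OnePoint ℂ) ⁻¹' {(p : OnePoint ℂ)}ᶜ = {p}ᶜ := by ext; simp
    rw [OnePoint.nhdsWithin_coe, e, frequently_map]
    intro hf
    have hf : ∃ᶠ x in 𝓝[≠] p, jEntire q ν x = 0 := hf.mono fun x hx => by
      obtain ⟨z, hz, hzx⟩ := hx
      rwa [← OnePoint.coe_injective hzx]
    have hdiff := differentiable_jEntire hq0 hq1 ν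
    have hp : jEntire q ν p = 0 :=
      (isClosed_eq hdiff.continuous continuous_const).mem_of_frequently_of_tendsto
        (hf.filter_mono nhdsWithin_le_nhds) tendsto_id
    exact hf ((hdiff p).hasDerivAt.eventually_ne (deriv_jEntire_ne_zero hq0 hq1 ν hp))

theorem theorem5p3 (q : ℝ) (hq0 : 0 < q) (hq1 : q < 1) (ν : ℝ) :
    -- no common zeros, except possibly `x = 0`
    (∀ x : ℂ, x ≠ 0 → ¬ (jFun q ν x = 0 ∧ jFun q (ν + 1) x = 0)) ∧
    -- the zeros are real, simple, symmetric about `0`, infinite in number,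
    -- and their only point of accumulation (in `ℂ ∪ {∞}`) is `∞`
    ((∀ x ∈ jZeros q ν, x.im = 0) ∧
      (∀ x ∈ jZeros q ν, analyticOrderAt (jEntire q ν) x = 1) ∧
      (∀ x : ℂ, x ∈ jZeros q ν ↔ -x ∈ jZeros q ν) ∧
      (jZeros q ν).Infinite ∧
      (∀ p : OnePoint ℂ,
        AccPt p (Filter.principal ((fun z : ℂ => (z : OnePoint ℂ)) '' jZeros q ν)) ↔
          p = OnePoint.infty)) ∧
    -- the positive zeros, numbered increasingly, interlace
    (∃ a b : ℕ → ℝ, StrictMono a ∧ StrictMono b ∧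
      Set.range a = jPosZeros q ν ∧ Set.range b = jPosZeros q (ν + 1) ∧
      ∀ n, a n < b n ∧ b n < a (n + 1)) ∧
    -- the smallest positive zeros exist, and the one of index `ν` is the smaller
    (∃ s t : ℝ, IsLeast (jPosZeros q ν) s ∧ IsLeast (jPosZeros q (ν + 1)) t ∧ s < t) := by
  have hI := exists_jPosZeros_interlacing hq0 hq1 ν
  refine ⟨fun x hx h => ?_, ⟨fun x hx => ?_, fun x hx => ?_, fun x => ?_, ?_,
    accPt_jZeros_iff hq0 hq1 ν⟩, hI, ?_⟩
  · rw [jFun_eq_zero_iff q _ hx, jFun_eq_zero_iff q _ hx] at h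
    exact jEntire_ne_zero_of_succ_eq_zero hq0 hq1 ν h.2 h.1
  · obtain ⟨y, hy, hxy, -⟩ := (jEntire_eq_zero_iff hq0 hq1 ν x).1 hx
    exact im_eq_zero_of_sq_eq_ofReal hy hxy
  · exact ((differentiable_jEntire hq0 hq1 ν).analyticAt x
      ).analyticOrderAt_eq_one_of_zero_deriv_ne_zero hx (deriv_jEntire_ne_zero hq0 hq1 ν hx)
  · simp [jZeros, jEntire]
  · obtain ⟨a, b, ha, -, hra, -⟩ := hI
    refine (Set.infinite_range_of_injective (ofReal_injective.comp ha.injective)).mono ?_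
    rintro _ ⟨n, rfl⟩
    have : a n ∈ jPosZeros q ν := hra ▸ Set.mem_range_self n
    exact this.2
  · obtain ⟨a, b, ha, hb, hra, hrb, hab⟩ := hI
    have hleast : ∀ c : ℕ → ℝ, StrictMono c → IsLeast (Set.range c) (c 0) := fun c hc =>
      ⟨Set.mem_range_self 0, by rintro _ ⟨n, rfl⟩; exact hc.monotone n.zero_le⟩
    exact ⟨a 0, b 0, hra ▸ hleast a ha, hrb ▸ hleast b hb, (hab 0).1⟩
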